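/- Let $n\ge 2$ be an integer, and let $\mathbb T^n=\mathbb R^n/\mathbb Z^n$ be the flat torus with the distance induced by the Euclidean norm $\|\cdot\|$. For $\tau>n-1$ and $\gamma\in(0,1)$ let $$\mathcal D^1_n(\tau,\gamma)=\bigl\{\alpha\in\mathbb R^n : \|\alpha\|=1,\ |k\cdot\alpha|\ge\gamma\|k\|^{-\tau}\ \text{for all } k\in\mathbb Z^n\setminus\{0\}\bigr\},$$ and suppose that $\tau$ and $\gamma$ are such that this set is nonempty. For $\alpha\in\mathbb R^n$ and $t\in\mathbb R$ let $\alpha_t(\theta)=\theta+t\alpha$ for $\theta\in\mathbb T^n$. One says that $\alpha_t$ fills $\mathbb T^n$ to within $\delta$ after time $T$ if, for every starting point $\theta\in\mathbb T^n$, every closed ball of radius $\delta$ in $\mathbb T^n$ contains a point of the orbit segment $\{\alpha_t(\theta): 0\le t\le T\}$. Then, for every $\delta\in(0,\tfrac12)$ and every $\alpha\in\mathcal D^1_n(\tau,\gamma)$, the flow $\alpha_t$ fills $\mathbb T^n$ to within $\delta$ after some time $T\ge 0$ with $$T<\frac{C(n,\tau)}{\gamma\,\delta^{\tau}},\qquad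 C(n,\tau)=(1+n^2\,n!)^{\tau+1}.$$ -/

import Mathlib

open scoped Nat

namespace TorusFilling

/-- The inclusion `ℤⁿ → ℝⁿ`, where `ℝⁿ` carries the Euclidean norm and inner product. -/
noncomputable def intVec (n : ℕ) : (Fin n → ℤ) →+ EuclideanSpace ℝ (Fin n) where
  toFun k := WithLp.toLp 2 (fun i => (k i : ℝ))
  map_zero' := by ext i; simp
  map_add' k l := by ext i; simp

/-- The lattice `ℤⁿ`, as a subgroup of `ℝⁿ`. -/
noncomputable def intLattice (n : ℕ) : AddSubgroup (EuclideanSpace ℝ (Fin n)) :=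
  (intVec n).range

/-- The flat torus `𝕋ⁿ = ℝⁿ / ℤⁿ`. It carries the quotient distance of the Euclidean one:
the distance of the classes of `x` and `y` is the infimum of `‖x - y + m‖` over `m ∈ ℤⁿ`. -/
abbrev Torus (n : ℕ) : Type :=
  EuclideanSpace ℝ (Fin n) ⧸ intLattice n

/-- Linear flow with direction vector `α`: the map `θ ↦ θ + t α` of the torus. -/
noncomputable def linearFlow {n : ℕ} (α : EuclideanSpace ℝ (Fin n)) (t : ℝ) (θ : Torus n) :
    Torus n :=
  θ + ((t • α : EuclideanSpace ℝ (Fin n)) : Torus n)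

/-- The orbit segment of `θ` over the times `0 ≤ t ≤ T`. -/
def orbitSegment {n : ℕ} (α : EuclideanSpace ℝ (Fin n)) (T : ℝ) (θ : Torus n) :
    Set (Torus n) :=
  {p | ∃ t : ℝ, 0 ≤ t ∧ t ≤ T ∧ p = linearFlow α t θ}

/-- A subset of the torus is `δ`-dense if it meets every closed ball of radius `δ`. -/
def IsDeltaDense {n : ℕ} (δ : ℝ) (S : Set (Torus n)) : Prop :=
  ∀ p : Torus n, (Metric.closedBall p δ ∩ S).Nonempty

/-- The linear flow with direction vector `α` fills the torus to within `δ` after time `T`. -/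
def Fills {n : ℕ} (α : EuclideanSpace ℝ (Fin n)) (δ T : ℝ) : Prop :=
  ∀ θ : Torus n, IsDeltaDense δ (orbitSegment α T θ)

/-- The Diophantine vectors in `ℝⁿ`: those `α` with `|k · α| ≥ γ ‖k‖ ^ (-τ)` for all nonzero
integer vectors `k`. -/
def diophantine (n : ℕ) (τ γ : ℝ) : Set (EuclideanSpace ℝ (Fin n)) :=
  {α | ∀ k : Fin n → ℤ, k ≠ 0 → γ * ‖intVec n k‖ ^ (-τ) ≤ |inner ℝ (intVec n k) α|}

/-- The Diophantine vectors of unit Euclidean length. -/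
def unitDiophantine (n : ℕ) (τ γ : ℝ) : Set (EuclideanSpace ℝ (Fin n)) :=
  Metric.sphere 0 1 ∩ diophantine n τ γ

/-- The constant `(1 + n² n!) ^ (τ + 1)`. -/
noncomputable def fillingConst (n : ℕ) (τ : ℝ) : ℝ :=
  (1 + (n : ℝ) ^ 2 * (n ! : ℝ)) ^ (τ + 1)

end TorusFilling

/-! ### Weighted orthogonality of exponentials with separated frequencies. -/

namespace TorusFilling

open MeasureTheory SchwartzMap
open scoped FourierTransform

/-! Test the orbit against `F(t) = ∏ i, P(e(x i + β i t))`, where `P` is a polynomial peaked at `1`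
on the unit circle. If `F` has enough mass in a bounded time window, then at some time there every
`x i + β i t` is close to an integer, in the summed-square sense.

The frequencies `j · β` of `F` are 2-separated when no small divisor is below 2, so the weight `‖𝓕
f‖²`, with `f` supported in `[-1, 1]`, makes them exactly orthogonal
(`integral_fourier_mul_expSum`). Applied to `f'`, the same identity bounds the mass at `|t| > 7`;
applied to the products `(1 - e(x i + β i t)) F(t)`, it shows that they are small in mean square.
Hence some `|t| ≤ 7` works (`exists_sum_norm_expSum_lt`, `exists_sum_sub_round_sq_lt`).

Rescaling time gives filling within `28 / ω` when `|k · α| ≥ ω` for nonzero `‖k‖ ≤ n / δ`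
(`fills_of_le_abs_inner`). The Diophantine condition supplies `ω = γ (n / δ) ^ (-τ)`, and `28 n ^ τ`
is below the stated constant. -/

theorem fourier_compSubConst (f : 𝓢(ℝ, ℂ)) (a w : ℝ) :
    𝓕 (f.compSubConstCLM ℂ (-a)) w = (𝐞 (a * w) : ℂ) * 𝓕 f w := by
  have h := congrFun (VectorFourier.fourierIntegral_comp_add_right 𝐞 volume
    (innerₗ ℝ) (f : ℝ → ℂ) a) w
  have e : ((f.compSubConstCLM ℂ (-a) : 𝓢(ℝ, ℂ)) : ℝ → ℂ) = (f : ℝ → ℂ) ∘ fun v => v + a := by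
    ext x; simp
  rw [fourier_coe, e]
  simpa [Circle.smul_def, mul_comm] using! h

/-- The exponential sum with frequencies `l` and coefficients `D`. -/
noncomputable def expSum {ι : Type*} [Fintype ι] (l : ι → ℝ) (D : ι → ℂ) (t : ℝ) : ℂ :=
  ∑ s, D s * (𝐞 (l s * t) : ℂ)

section expSum

variable {ι : Type*} [Fintype ι]

/-- The superposition of translates of `f` whose Fourier transform is `𝓕 f` times an exponential
sum. -/
noncomputable def translateSum (f : 𝓢(ℝ, ℂ)) (l : ι → ℝ) (D : ι → ℂ) : 𝓢(ℝ, ℂ) :=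
  ∑ s, D s • f.compSubConstCLM ℂ (-l s)

theorem fourier_translateSum (f : 𝓢(ℝ, ℂ)) (l : ι → ℝ) (D : ι → ℂ) (t : ℝ) :
    𝓕 (translateSum f l D) t = 𝓕 f t * expSum l D t := by
  have : 𝓕 (translateSum f l D) = ∑ s, D s • 𝓕 (f.compSubConstCLM ℂ (-l s)) := by
    simp only [translateSum, ← FourierTransform.fourierCLM_apply (R := ℂ), map_sum, map_smul]
  rw [this]
  simp only [_root_.sum_apply, _root_.smul_apply, fourier_compSubConst, expSum,
    Finset.mul_sum, smul_eq_mul]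
  exact Finset.sum_congr rfl fun s _ => by ring

theorem integrable_norm_sq (f : 𝓢(ℝ, ℂ)) : Integrable fun x => ‖f x‖ ^ 2 :=
  (f.memLp 2 volume).integrable_norm_pow (by norm_num)

theorem integrable_fourier_mul_expSum (f : 𝓢(ℝ, ℂ)) (l : ι → ℝ) (D : ι → ℂ) :
    Integrable fun t => ‖𝓕 f t‖ ^ 2 * ‖expSum l D t‖ ^ 2 := by
  have := integrable_norm_sq (𝓕 (translateSum f l D))
  simpa only [fourier_translateSum, norm_mul, mul_pow] using this

theorem norm_sum_sq_of_pairwise {E : ι → ℂ} (h : ∀ s s', s ≠ s' → E s = 0 ∨ E s' = 0) :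
    ‖∑ s, E s‖ ^ 2 = ∑ s, ‖E s‖ ^ 2 := by
  by_cases hE : ∃ s, E s ≠ 0
  · obtain ⟨s, hs⟩ := hE
    have h0 : ∀ s', s' ≠ s → E s' = 0 := fun s' hs' => (h s' s hs').resolve_right hs
    rw [Fintype.sum_eq_single s h0, Fintype.sum_eq_single s fun s' hs' => by simp [h0 s' hs']]
  · push Not at hE
    simp [hE]

/-- Orthogonality of exponentials with `2`-separated frequencies for the weight `‖𝓕 f‖²`, where `f`
is supported in the unit interval. -/
theorem integral_fourier_mul_expSum (f : 𝓢(ℝ, ℂ)) (hf : ∀ x, 1 ≤ |x| → f x = 0) (l : ι → ℝ)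
    (hl : ∀ s s', s ≠ s' → 2 ≤ |l s - l s'|) (D : ι → ℂ) :
    ∫ t, ‖𝓕 f t‖ ^ 2 * ‖expSum l D t‖ ^ 2 = (∫ x, ‖f x‖ ^ 2) * ∑ s, ‖D s‖ ^ 2 := by
  have h1 := integral_norm_sq_fourier (translateSum f l D)
  simp only [fourier_translateSum, norm_mul, mul_pow] at h1
  rw [h1]
  -- By Plancherel it suffices to work with the translates of `f`; their supports are essentially
  -- disjoint, so no cross terms survive.
  have h2 : ∀ x, ‖translateSum f l D x‖ ^ 2 = ∑ s, ‖D s‖ ^ 2 * ‖f (x + l s)‖ ^ 2 := by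
    intro x
    have : translateSum f l D x = ∑ s, D s * f (x + l s) := by
      simp [translateSum]
    rw [this, norm_sum_sq_of_pairwise]
    · simp only [norm_mul, mul_pow]
    · intro s s' hs
      have : 1 ≤ |x + l s| ∨ 1 ≤ |x + l s'| := by
        by_contra! hc
        have := hl s s' hs
        have h3 := abs_sub (x + l s) (x + l s')
        rw [add_sub_add_left_eq_sub] at h3
        linarith
      rcases this with h | h
      · left; rw [hf _ h, mul_zero]
      · right; rw [hf _ h, mul_zero]
  simp only [h2]
  rw [integral_finsetSum _ fun s _ => ((integrable_norm_sq f).comp_add_right (l s)).const_mul _,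
    Finset.mul_sum]
  refine Finset.sum_congr rfl fun s _ => ?_
  rw [integral_const_mul, integral_add_right_eq_self (fun x => ‖f x‖ ^ 2) (l s), mul_comm]

end expSum

/-! ### A bump function and the second moment of its Fourier transform. -/

theorem norm_fourier_deriv_sq (f : 𝓢(ℝ, ℂ)) (t : ℝ) :
    ‖𝓕 (derivCLM ℂ ℂ f) t‖ ^ 2 = 4 * Real.pi ^ 2 * (t ^ 2 * ‖𝓕 f t‖ ^ 2) := by
  have h := congrFun (Real.fourier_deriv f.integrable f.differentiable
    (derivCLM ℂ ℂ f).integrable) t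
  have e : ((derivCLM ℂ ℂ f : 𝓢(ℝ, ℂ)) : ℝ → ℂ) = deriv f := by ext x; simp
  rw [fourier_coe, e, h]
  simp only [smul_eq_mul, norm_mul, fourier_coe]
  simp [abs_of_pos Real.pi_pos, mul_pow]
  ring

/-- The standard bump function on `[-1, 1]`. -/
noncomputable def bump (x : ℝ) : ℝ := expNegInvGlue (1 - x ^ 2)

theorem bump_eq_zero {x : ℝ} (hx : 1 ≤ |x|) : bump x = 0 :=
  expNegInvGlue.zero_of_nonpos (by nlinarith [one_le_sq_iff_one_le_abs x |>.2 hx])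

theorem expNegInvGlue_hasDerivAt (y : ℝ) :
    HasDerivAt expNegInvGlue (y⁻¹ ^ 2 * expNegInvGlue y) y := by
  simpa using expNegInvGlue.hasDerivAt_polynomial_eval_inv_mul 1 y

/-- For `y > 0` put `s = 1 / y` and use `exp s ≥ 1 + s + s² / 2`. -/
theorem inv_sq_mul_expNegInvGlue_le (y : ℝ) : y⁻¹ ^ 2 * expNegInvGlue y ≤ 2 := by
  rcases le_or_gt y 0 with hy | hy
  · simp [expNegInvGlue.zero_of_nonpos hy]
  · have h := Real.quadratic_le_exp_of_nonneg (inv_nonneg.2 hy.le)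
    have h0 := inv_pos.2 hy
    rw [expNegInvGlue, if_neg hy.not_ge, Real.exp_neg, ← div_eq_mul_inv,
      div_le_iff₀ (Real.exp_pos _)]
    nlinarith

theorem bump_hasDerivAt (x : ℝ) :
    HasDerivAt bump ((1 - x ^ 2)⁻¹ ^ 2 * expNegInvGlue (1 - x ^ 2) * (-(2 * x))) x := by
  have h : HasDerivAt (fun x : ℝ => 1 - x ^ 2) (-(2 * x)) x := by
    simpa using (hasDerivAt_pow 2 x).const_sub 1
  exact (expNegInvGlue_hasDerivAt _).comp x h

theorem bump_contDiff : ContDiff ℝ ((⊤ : ℕ∞) : WithTop ℕ∞) bump :=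
  expNegInvGlue.contDiff.comp (by fun_prop)

/-- The standard bump function as a complex Schwartz function. -/
noncomputable def bumpSchwartz : 𝓢(ℝ, ℂ) :=
  HasCompactSupport.toSchwartzMap (f := fun x => (bump x : ℂ))
    (HasCompactSupport.intro (isCompact_Icc (a := (-1 : ℝ)) (b := 1)) fun x hx => by
      rw [bump_eq_zero, Complex.ofReal_zero]
      by_contra! h
      exact hx (abs_le.1 h.le))
    (Complex.ofRealCLM.contDiff.comp bump_contDiff)

theorem bumpSchwartz_apply (x : ℝ) : bumpSchwartz x = (bump x : ℂ) := rfl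

theorem bumpSchwartz_eq_zero {x : ℝ} (hx : 1 ≤ |x|) : bumpSchwartz x = 0 := by
  rw [bumpSchwartz_apply, bump_eq_zero hx, Complex.ofReal_zero]

theorem deriv_bumpSchwartz_apply (x : ℝ) : derivCLM ℂ ℂ bumpSchwartz x =
    (((1 - x ^ 2)⁻¹ ^ 2 * expNegInvGlue (1 - x ^ 2) * (-(2 * x)) : ℝ) : ℂ) := by
  rw [derivCLM_apply]
  exact (bump_hasDerivAt x).ofReal_comp.deriv

theorem deriv_bumpSchwartz_eq_zero {x : ℝ} (hx : 1 ≤ |x|) : derivCLM ℂ ℂ bumpSchwartz x = 0 := by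
  have : expNegInvGlue (1 - x ^ 2) = 0 := bump_eq_zero hx
  rw [deriv_bumpSchwartz_apply, this]
  simp

theorem norm_deriv_bumpSchwartz_sq_le (x : ℝ) :
    ‖derivCLM ℂ ℂ bumpSchwartz x‖ ^ 2 ≤ (Set.Icc (-1 : ℝ) 1).indicator (fun _ => 16) x := by
  by_cases hx : |x| ≤ 1
  · rw [Set.indicator_of_mem (Set.mem_Icc.2 (abs_le.1 hx)), deriv_bumpSchwartz_apply, Complex.norm_real,
      Real.norm_eq_abs, abs_mul, abs_neg, abs_mul 2, abs_two]
    have h1 := inv_sq_mul_expNegInvGlue_le (1 - x ^ 2)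
    have h0 : 0 ≤ (1 - x ^ 2)⁻¹ ^ 2 * expNegInvGlue (1 - x ^ 2) :=
      mul_nonneg (sq_nonneg _) (expNegInvGlue.nonneg _)
    rw [abs_of_nonneg h0]
    have h2 : (1 - x ^ 2)⁻¹ ^ 2 * expNegInvGlue (1 - x ^ 2) * (2 * |x|) ≤ 2 * (2 * 1) := by
      gcongr
    have h3 : 0 ≤ (1 - x ^ 2)⁻¹ ^ 2 * expNegInvGlue (1 - x ^ 2) * (2 * |x|) := by positivity
    nlinarith
  · rw [deriv_bumpSchwartz_eq_zero (not_le.1 hx).le]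
    simp only [norm_zero]
    rw [zero_pow two_ne_zero]
    exact Set.indicator_nonneg (fun _ _ => by norm_num) _

theorem integral_norm_deriv_bumpSchwartz_sq_le :
    ∫ x, ‖derivCLM ℂ ℂ bumpSchwartz x‖ ^ 2 ≤ 32 := by
  calc _ ≤ ∫ x, (Set.Icc (-1 : ℝ) 1).indicator (fun _ => (16 : ℝ)) x :=
        integral_mono (integrable_norm_sq _)
          ((integrable_indicator_iff measurableSet_Icc).2 (by simp)) norm_deriv_bumpSchwartz_sq_le
    _ = 32 := by
        rw [integral_indicator measurableSet_Icc]
        simp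
        norm_num

theorem le_integral_norm_bumpSchwartz_sq : (201 / 10 : ℝ)⁻¹ ≤ ∫ x, ‖bumpSchwartz x‖ ^ 2 := by
  have hexp : Real.exp 3 ≤ 201 / 10 := by
    have h := Real.exp_one_lt_d9
    have : Real.exp 3 = Real.exp 1 ^ 3 := by rw [← Real.exp_nat_mul]; norm_num
    rw [this]
    calc Real.exp 1 ^ 3 ≤ (2.7183 : ℝ) ^ 3 := by gcongr; linarith
      _ ≤ _ := by norm_num
  calc (201 / 10 : ℝ)⁻¹ ≤ Real.exp (-3) := by
        rw [Real.exp_neg]; gcongr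
    _ = ∫ x, (Set.Icc (-(1 / 2) : ℝ) (1 / 2)).indicator (fun _ => Real.exp (-3)) x := by
        rw [integral_indicator measurableSet_Icc]
        simp
        norm_num
    _ ≤ _ := by
        refine integral_mono ((integrable_indicator_iff measurableSet_Icc).2 (by simp))
          (integrable_norm_sq _) fun x => ?_
        revert x
        refine Set.indicator_le' (g := fun x => ‖bumpSchwartz x‖ ^ 2) (fun x hx => ?_)
          fun x _ => sq_nonneg _
        -- On `[-1/2, 1/2]` the squared bump is at least `exp (-8/3) ≥ exp (-3)`.
        have hx2 : x ^ 2 ≤ 1 / 4 := by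
          have := abs_le.2 hx
          rw [← sq_abs]; nlinarith [abs_nonneg x]
        rw [bumpSchwartz_apply, Complex.norm_real, Real.norm_eq_abs, sq_abs, bump, expNegInvGlue,
          if_neg (by linarith), ← Real.exp_nat_mul]
        apply Real.exp_le_exp.2
        have : (1 - x ^ 2)⁻¹ ≤ (3 / 4 : ℝ)⁻¹ := by gcongr; linarith
        push_cast
        norm_num at this
        linarith

/-- By Plancherel, the second moment of `‖𝓕 f‖²` is at most 18 times its mass; this is the tail
bound beyond `|t| = 7`. -/
theorem integral_norm_deriv_bumpSchwartz_sq_le_mul :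
    ∫ x, ‖derivCLM ℂ ℂ bumpSchwartz x‖ ^ 2 ≤
      4 * Real.pi ^ 2 * (18 * ∫ x, ‖bumpSchwartz x‖ ^ 2) := by
  have h1 := integral_norm_deriv_bumpSchwartz_sq_le
  have h2 := le_integral_norm_bumpSchwartz_sq
  have h3 : (9 : ℝ) ≤ Real.pi ^ 2 := by nlinarith [Real.pi_gt_three]
  calc _ ≤ (32 : ℝ) := h1
    _ ≤ 4 * 9 * (18 * (201 / 10 : ℝ)⁻¹) := by norm_num
    _ ≤ _ := by gcongr

/-- If the exponential sums with coefficients `D' i` have small total mass, relative to that with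
coefficients `D`, then they are smaller at some time in a fixed interval. -/
theorem exists_sum_norm_expSum_lt {ι κ : Type*} [Fintype ι] [Fintype κ] (l : ι → ℝ)
    (hl : ∀ s s', s ≠ s' → 2 ≤ |l s - l s'|) (D : ι → ℂ) (D' : κ → ι → ℂ)
    (hD : 0 < ∑ s, ‖D s‖ ^ 2) (hD' : ∑ i, ∑ s, ‖D' i s‖ ^ 2 ≤ 5 / 8 * ∑ s, ‖D s‖ ^ 2) :
    ∃ t : ℝ, |t| ≤ 7 ∧ ∑ i, ‖expSum l (D' i) t‖ ^ 2 < ‖expSum l D t‖ ^ 2 := by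
  by_contra! hc
  set f := bumpSchwartz
  set A := ∫ x, ‖f x‖ ^ 2
  have hA : 0 < A := lt_of_lt_of_le (by norm_num) le_integral_norm_bumpSchwartz_sq
  have hI := integral_fourier_mul_expSum f (fun x => bumpSchwartz_eq_zero) l hl
  have hJ := integral_fourier_mul_expSum (derivCLM ℂ ℂ f)
    (fun x => deriv_bumpSchwartz_eq_zero) l hl D
  have hint := integrable_fourier_mul_expSum (derivCLM ℂ ℂ f) l D
  simp only [norm_fourier_deriv_sq] at hJ hint
  -- The negated claim covers `|t| ≤ 7`; elsewhere `t² / 49 ≥ 1`, as in Chebyshev's inequality.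
  have hpt : ∀ t, ‖𝓕 f t‖ ^ 2 * ‖expSum l D t‖ ^ 2 ≤
      (4 * Real.pi ^ 2 * 49)⁻¹ * (4 * Real.pi ^ 2 * (t ^ 2 * ‖𝓕 f t‖ ^ 2) * ‖expSum l D t‖ ^ 2) +
      ∑ i, ‖𝓕 f t‖ ^ 2 * ‖expSum l (D' i) t‖ ^ 2 := by
    intro t
    have e : (4 * Real.pi ^ 2 * 49)⁻¹ *
        (4 * Real.pi ^ 2 * (t ^ 2 * ‖𝓕 f t‖ ^ 2) * ‖expSum l D t‖ ^ 2) =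
        t ^ 2 / 49 * (‖𝓕 f t‖ ^ 2 * ‖expSum l D t‖ ^ 2) := by
      field_simp
    rw [e, ← Finset.mul_sum]
    rcases le_or_gt |t| 7 with ht | ht
    · have := mul_le_mul_of_nonneg_left (hc t ht) (sq_nonneg ‖𝓕 f t‖)
      have h0 : 0 ≤ t ^ 2 / 49 * (‖𝓕 f t‖ ^ 2 * ‖expSum l D t‖ ^ 2) := by positivity
      linarith
    · have h1 : 1 ≤ t ^ 2 / 49 := by
        rw [← sq_abs, le_div_iff₀ (by norm_num)]; nlinarith
      have h0 : 0 ≤ ‖𝓕 f t‖ ^ 2 * ∑ i, ‖expSum l (D' i) t‖ ^ 2 := by positivity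
      have h2 : 0 ≤ ‖𝓕 f t‖ ^ 2 * ‖expSum l D t‖ ^ 2 := by positivity
      nlinarith
  have hs : Integrable fun t => ∑ i, ‖𝓕 f t‖ ^ 2 * ‖expSum l (D' i) t‖ ^ 2 :=
    integrable_finsetSum _ fun i _ => integrable_fourier_mul_expSum f l (D' i)
  have key := integral_mono (integrable_fourier_mul_expSum f l D) ((hint.const_mul _).add hs) hpt
  simp only [Pi.add_apply] at key
  rw [integral_add (hint.const_mul _) hs, integral_const_mul, hI, hJ,
    integral_finsetSum _ fun i _ => integrable_fourier_mul_expSum f l (D' i)] at key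
  simp only [hI] at key
  rw [← Finset.mul_sum] at key
  have hB := integral_norm_deriv_bumpSchwartz_sq_le_mul
  have h1 : (4 * Real.pi ^ 2 * 49)⁻¹ * ((∫ x, ‖derivCLM ℂ ℂ f x‖ ^ 2) * ∑ s, ‖D s‖ ^ 2) ≤
      (4 * Real.pi ^ 2 * 49)⁻¹ * ((4 * Real.pi ^ 2 * (18 * A)) * ∑ s, ‖D s‖ ^ 2) := by
    gcongr
  have e : (4 * Real.pi ^ 2 * 49)⁻¹ * ((4 * Real.pi ^ 2 * (18 * A)) * ∑ s, ‖D s‖ ^ 2) =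
      18 / 49 * (A * ∑ s, ‖D s‖ ^ 2) := by
    field_simp
  have h2 := mul_le_mul_of_nonneg_left hD' hA.le
  have h3 : 0 < A * ∑ s, ‖D s‖ ^ 2 := by positivity
  -- The contradiction is `18/49 + 5/8 < 1`.
  linarith

end TorusFilling

/-! ### Peaked trigonometric polynomials and approach to the integer lattice. -/

namespace TorusFilling

open scoped FourierTransform

theorem coe_fourierChar_add (u v : ℝ) : (𝐞 (u + v) : ℂ) = 𝐞 u * 𝐞 v := by
  rw [AddChar.map_add_eq_mul, Circle.coe_mul]

theorem coe_fourierChar_nat_mul (m : ℕ) (u : ℝ) : (𝐞 (m * u) : ℂ) = (𝐞 u : ℂ) ^ m := by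
  rw [← nsmul_eq_mul, AddChar.map_nsmul_eq_pow, Circle.coe_pow]

theorem coe_fourierChar_sum {ι : Type*} (S : Finset ι) (u : ι → ℝ) :
    (𝐞 (∑ i ∈ S, u i) : ℂ) = ∏ i ∈ S, (𝐞 (u i) : ℂ) := by
  classical
  induction S using Finset.induction_on with
  | empty => simp
  | insert i S hi ih => rw [Finset.sum_insert hi, Finset.prod_insert hi, coe_fourierChar_add, ih]

/-- `|1 - e(u)| = 2 |sin (π v)|` with `|v| ≤ 1/2`, and Jordan's inequality gives at least `4 |v|`.
-/
theorem sixteen_mul_dist_round_sq_le (u : ℝ) : 16 * (u - round u) ^ 2 ≤ ‖1 - (𝐞 u : ℂ)‖ ^ 2 := by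
  set v := u - round u with hv
  have hu : (𝐞 u : ℂ) = Complex.exp (Complex.I * (2 * Real.pi * v : ℝ)) := by
    rw [Real.fourierChar_apply, Complex.exp_eq_exp_iff_exists_int]
    refine ⟨round u, ?_⟩
    rw [hv]
    push_cast
    ring
  have hs := Real.mul_abs_le_abs_sin (x := Real.pi * v) (by
    rw [abs_mul, abs_of_pos Real.pi_pos]
    have := abs_sub_round u
    nlinarith [Real.pi_pos])
  rw [abs_mul, abs_of_pos Real.pi_pos, ← mul_assoc, div_mul_cancel₀ _ Real.pi_ne_zero] at hs
  rw [norm_sub_rev, hu, Complex.norm_exp_I_mul_ofReal_sub_one, Real.norm_eq_abs, sq_abs,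
    mul_pow, show 2 * Real.pi * v / 2 = Real.pi * v by ring, ← sq_abs v,
    ← sq_abs (Real.sin _)]
  nlinarith [abs_nonneg v]

theorem expSum_prod {n M : ℕ} (a : Fin n → Fin M → ℂ) (x β : Fin n → ℝ) (t : ℝ) :
    expSum (fun j : Fin n → Fin M => ∑ i, (j i : ℝ) * β i)
      (fun j => ∏ i, a i (j i) * (𝐞 ((j i : ℕ) * x i) : ℂ)) t =
    ∏ i, ∑ m, a i m * (𝐞 (x i + β i * t) : ℂ) ^ (m : ℕ) := by
  rw [Finset.prod_univ_sum, Fintype.piFinset_univ, expSum]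
  refine Finset.sum_congr rfl fun j _ => ?_
  rw [Finset.sum_mul, coe_fourierChar_sum, ← Finset.prod_mul_distrib]
  refine Finset.prod_congr rfl fun i _ => ?_
  rw [mul_assoc, mul_assoc, coe_fourierChar_nat_mul, coe_fourierChar_nat_mul, ← mul_pow,
    ← coe_fourierChar_add]

theorem sum_norm_prod_sq {n M : ℕ} (a : Fin n → Fin M → ℂ) (x : Fin n → ℝ) :
    ∑ j : Fin n → Fin M, ‖∏ i, a i (j i) * (𝐞 ((j i : ℕ) * x i) : ℂ)‖ ^ 2 =
      ∏ i, ∑ m, ‖a i m‖ ^ 2 := by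
  rw [Finset.prod_univ_sum, Fintype.piFinset_univ]
  refine Finset.sum_congr rfl fun j _ => ?_
  simp only [norm_prod, norm_mul, Circle.norm_coe, mul_one, Finset.prod_pow]

/-- The coefficients of a polynomial that peaks at `1` on the unit circle. -/
noncomputable def peakCoeff (M : ℕ) (m : Fin M) : ℂ := (((m + 1) * (M - 1 - m) : ℝ) : ℂ)

/-- The coefficients of the product of `1 - z` and the polynomial with coefficients `peakCoeff`. -/
noncomputable def peakDiffCoeff (M : ℕ) (m : Fin M) : ℂ := ((M - 1 - 2 * m : ℝ) : ℂ)

/-- The last peak coefficient, at `m = M - 1`, is zero, so multiplying by `1 - z` stays within `M`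
coefficients and needs no new frequencies. -/
theorem one_sub_mul_sum_peakCoeff (M : ℕ) (z : ℂ) :
    ∑ m, peakDiffCoeff M m * z ^ (m : ℕ) = (1 - z) * ∑ m, peakCoeff M m * z ^ (m : ℕ) := by
  have h : ∀ K : ℕ, (1 - z) * ∑ m ∈ Finset.range K, ((m : ℂ) + 1) * (M - 1 - m) * z ^ m =
      ∑ m ∈ Finset.range K, ((M : ℂ) - 1 - 2 * m) * z ^ m - K * (M - K) * z ^ K := by
    intro K
    induction K with
    | zero => simp
    | succ K ih =>
      rw [Finset.sum_range_succ, Finset.sum_range_succ, mul_add, ih]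
      push_cast
      ring
  have hM := h M
  rw [sub_self, mul_zero, zero_mul, sub_zero, Finset.sum_range, Finset.sum_range] at hM
  simp only [peakCoeff, peakDiffCoeff]
  push_cast
  exact hM.symm

theorem sum_norm_peakCoeff_sq (M : ℕ) :
    ∑ m, ‖peakCoeff M m‖ ^ 2 = M * ((M : ℝ) ^ 4 - 1) / 30 := by
  have h : ∀ K : ℕ, ∑ m ∈ Finset.range K, (((m : ℝ) + 1) * (M - 1 - m)) ^ 2 =
      (K * (K + 1) * (2 * K + 1) / 6 : ℝ) * M ^ 2 - 2 * M * (K * (K + 1) / 2) ^ 2 +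
        K * (K + 1) * (2 * K + 1) * (3 * K ^ 2 + 3 * K - 1) / 30 := by
    intro K
    induction K with
    | zero => simp
    | succ K ih => rw [Finset.sum_range_succ, ih]; push_cast; ring
  have hM := h M
  rw [Finset.sum_range] at hM
  simp only [peakCoeff, Complex.norm_real, Real.norm_eq_abs, sq_abs]
  rw [hM]
  ring

theorem sum_norm_peakDiffCoeff_sq (M : ℕ) :
    ∑ m, ‖peakDiffCoeff M m‖ ^ 2 = M * ((M : ℝ) ^ 2 - 1) / 3 := by
  have h : ∀ K : ℕ, ∑ m ∈ Finset.range K, ((M : ℝ) - 1 - 2 * m) ^ 2 =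
      K * (M - 1 : ℝ) ^ 2 - 2 * (M - 1) * (K * (K - 1)) + 2 * (K * (K - 1) * (2 * K - 1)) / 3 := by
    intro K
    induction K with
    | zero => simp
    | succ K ih => rw [Finset.sum_range_succ, ih]; push_cast; ring
  have hM := h M
  rw [Finset.sum_range] at hM
  simp only [peakDiffCoeff, Complex.norm_real, Real.norm_eq_abs, sq_abs]
  rw [hM]
  ring

/-- If all nonzero integer vectors `k` in a box have `|k · β| ≥ 2`, then a line of direction `β`
comes close to the integer lattice within a bounded time. -/
theorem exists_sum_sub_round_sq_lt {n M : ℕ} (hM : 2 ≤ M) (x β : Fin n → ℝ)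
    (hβ : ∀ k : Fin n → ℤ, k ≠ 0 → (∀ i, |(k i : ℝ)| ≤ M - 1) → 2 ≤ |∑ i, (k i : ℝ) * β i|)
    {δ : ℝ} (hδ : 0 < δ) (hnM : n ≤ δ ^ 2 * M ^ 2) :
    ∃ t : ℝ, |t| ≤ 7 ∧ ∑ i, (x i + β i * t - round (x i + β i * t)) ^ 2 < δ ^ 2 := by
  classical
  have hM' : (2 : ℝ) ≤ M := by exact_mod_cast hM
  set C : ℝ := ∑ m, ‖peakCoeff M m‖ ^ 2 with hC
  set E : ℝ := ∑ m, ‖peakDiffCoeff M m‖ ^ 2 with hE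
  have hCpos : 0 < C := by
    rw [hC, sum_norm_peakCoeff_sq]
    have : (1 : ℝ) < (M : ℝ) ^ 4 := one_lt_pow₀ (by linarith) (by norm_num)
    have : 0 < (M : ℝ) ^ 4 - 1 := by linarith
    positivity
  have hE0 : 0 ≤ E := by rw [hE]; positivity
  -- Multiplication by `1 - z` shrinks the squared coefficient norm by exactly `10 / (M² + 1)`.
  have hEC : E * M ^ 2 ≤ 10 * C := by
    have : E * (M ^ 2 + 1) = 10 * C := by
      rw [hE, hC, sum_norm_peakCoeff_sq, sum_norm_peakDiffCoeff_sq]; ring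
    linarith
  -- In the `i`-th product only the `i`-th factor `P` is replaced by `(1 - z) P`.
  let a : Fin n → Fin n → Fin M → ℂ :=
    fun i => Function.update (fun _ => peakCoeff M) i (peakDiffCoeff M)
  let D : (Fin n → Fin M) → ℂ := fun j => ∏ i, peakCoeff M (j i) * (𝐞 ((j i : ℕ) * x i) : ℂ)
  let B : Fin n → (Fin n → Fin M) → ℂ := fun i j =>
    ∏ l, a i l (j l) * (𝐞 ((j l : ℕ) * x l) : ℂ)
  -- The scaling `1 / (4 δ)` matches `16 v² ≤ |1 - e(u)|²`; the total mass ratio becomes `10 n / (16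
  -- δ² M²) ≤ 5/8`.
  let D' : Fin n → (Fin n → Fin M) → ℂ := fun i j => ((4 * δ)⁻¹ : ℝ) * B i j
  let l : (Fin n → Fin M) → ℝ := fun j => ∑ i, (j i : ℝ) * β i
  have hDsum : ∑ s, ‖D s‖ ^ 2 = C ^ n := by
    have := sum_norm_prod_sq (fun _ : Fin n => peakCoeff M) x
    simpa [D, ← hC] using this
  have hBsum : ∀ i, ∑ s, ‖B i s‖ ^ 2 * M ^ 2 ≤ 10 * C ^ n := by
    intro i
    have h := sum_norm_prod_sq (a i) x
    rw [← Finset.sum_mul, h, ← Finset.mul_prod_erase _ _ (Finset.mem_univ i)]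
    have h1 : ∏ l ∈ Finset.univ.erase i, ∑ m, ‖a i l m‖ ^ 2 = C ^ (n - 1) := by
      rw [Finset.prod_congr rfl (g := fun _ => C)]
      · simp
      · intro l hl
        simp [a, Function.update_of_ne (Finset.ne_of_mem_erase hl), hC]
    have h2 : ∑ m, ‖a i i m‖ ^ 2 = E := by simp [a, hE]
    rw [h1, h2]
    have hn : C ^ n = C * C ^ (n - 1) := by
      rw [← pow_succ', Nat.sub_add_cancel i.pos]
    rw [hn, mul_right_comm, ← mul_assoc]
    gcongr
  have hl : ∀ s s', s ≠ s' → 2 ≤ |l s - l s'| := by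
    intro s s' hs
    have h := hβ (fun i => (s i : ℤ) - (s' i : ℤ)) ?_ ?_
    · simpa [l, ← Finset.sum_sub_distrib, sub_mul] using h
    · intro h0
      apply hs
      ext i
      have := congrFun h0 i
      simp only [Pi.zero_apply] at this
      omega
    · intro i
      have h1 := (s i).isLt
      have h2 := (s' i).isLt
      have h3 : |(s i : ℤ) - (s' i : ℤ)| ≤ (M : ℤ) - 1 := by
        rw [abs_le]; omega
      exact_mod_cast h3
  obtain ⟨t, ht, hlt⟩ := exists_sum_norm_expSum_lt l hl D D' (by rw [hDsum]; positivity) (by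
    rw [hDsum]
    have h1 : ∀ i, ∑ s, ‖D' i s‖ ^ 2 ≤ (16 * δ ^ 2 * M ^ 2)⁻¹ * (10 * C ^ n) := by
      intro i
      refine le_trans (le_of_eq ?_) (mul_le_mul_of_nonneg_left (hBsum i) (by positivity))
      rw [Finset.mul_sum]
      refine Finset.sum_congr rfl fun s _ => ?_
      simp only [D', norm_mul, Complex.norm_real, Real.norm_eq_abs, mul_pow, sq_abs]
      field_simp
      ring
    refine (Finset.sum_le_sum fun i _ => h1 i).trans ?_
    simp only [Finset.sum_const, Finset.card_univ, Fintype.card_fin, nsmul_eq_mul]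
    calc (n : ℝ) * ((16 * δ ^ 2 * M ^ 2)⁻¹ * (10 * C ^ n))
        ≤ (δ ^ 2 * M ^ 2) * ((16 * δ ^ 2 * M ^ 2)⁻¹ * (10 * C ^ n)) := by gcongr
      _ = 5 / 8 * C ^ n := by field_simp; norm_num)
  refine ⟨t, ht, ?_⟩
  have hF : expSum l D t = ∏ i, ∑ m, peakCoeff M m * (𝐞 (x i + β i * t) : ℂ) ^ (m : ℕ) :=
    expSum_prod (fun _ => peakCoeff M) x β t
  have hB : ∀ i, expSum l (B i) t = (1 - (𝐞 (x i + β i * t) : ℂ)) * expSum l D t := by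
    intro i
    have h := expSum_prod (a i) x β t
    refine h.trans ?_
    rw [hF, ← Finset.mul_prod_erase _ _ (Finset.mem_univ i),
      ← Finset.mul_prod_erase Finset.univ (fun i => ∑ m, peakCoeff M m * _) (Finset.mem_univ i),
      ← mul_assoc, ← one_sub_mul_sum_peakCoeff]
    congr 1
    · simp [a]
    · refine Finset.prod_congr rfl fun l hl => ?_
      simp [a, Function.update_of_ne (Finset.ne_of_mem_erase hl)]
  have hD' : ∀ i, ‖expSum l (D' i) t‖ ^ 2 =
      (16 * δ ^ 2)⁻¹ * (‖1 - (𝐞 (x i + β i * t) : ℂ)‖ ^ 2 * ‖expSum l D t‖ ^ 2) := by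
    intro i
    have : expSum l (D' i) t = ((4 * δ)⁻¹ : ℝ) * expSum l (B i) t := by
      simp only [expSum, D', Finset.mul_sum, mul_assoc]
    rw [this, hB, norm_mul, norm_mul, Complex.norm_real, Real.norm_eq_abs, mul_pow, sq_abs, mul_pow]
    congr 1
    rw [inv_pow]
    congr 1
    ring
  simp only [hD', ← Finset.mul_sum, ← Finset.sum_mul] at hlt
  -- Strictness of the inequality rules out a zero of `F`, so it can be divided out.
  have hFpos : 0 < ‖expSum l D t‖ ^ 2 := lt_of_le_of_lt (by positivity) hlt
  rw [← mul_assoc] at hlt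
  have h1 := lt_of_mul_lt_mul_right (hlt.trans_eq (one_mul _).symm) hFpos.le
  rw [inv_mul_lt_iff₀ (by positivity), mul_one] at h1
  have h2 := Finset.sum_le_sum fun i (_ : i ∈ Finset.univ) =>
    sixteen_mul_dist_round_sq_le (x i + β i * t)
  rw [← Finset.mul_sum] at h2
  linarith

end TorusFilling

/-! ### From lattice approximation to filling the torus. -/

namespace TorusFilling

theorem norm_mk_le_of_sum_sub_round {n : ℕ} (y : EuclideanSpace ℝ (Fin n)) {δ : ℝ} (hδ : 0 ≤ δ)
    (hy : ∑ i, (y i - round (y i)) ^ 2 ≤ δ ^ 2) : ‖(y : Torus n)‖ ≤ δ := by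
  have h : (y : Torus n) = ((y - intVec n fun i => round (y i) : EuclideanSpace ℝ (Fin n)) :
      Torus n) := by
    rw [QuotientAddGroup.eq]
    exact ⟨-fun i => round (y i), by rw [map_neg]; abel⟩
  rw [h]
  refine QuotientAddGroup.norm_mk_le_norm.trans ?_
  rw [EuclideanSpace.norm_eq]
  refine Real.sqrt_le_iff.2 ⟨hδ, ?_⟩
  simpa [intVec] using hy

theorem inner_intVec {n : ℕ} (k : Fin n → ℤ) (α : EuclideanSpace ℝ (Fin n)) :
    inner ℝ (intVec n k) α = ∑ i, (k i : ℝ) * α i := by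
  simp [intVec, PiLp.inner_apply, mul_comm]

theorem intVec_eq_zero {n : ℕ} {k : Fin n → ℤ} : intVec n k = 0 ↔ k = 0 := by
  refine ⟨fun h => ?_, fun h => by rw [h, map_zero]⟩
  ext i
  have : (intVec n k) i = 0 := by rw [h]; rfl
  simpa [intVec] using this

theorem norm_intVec_le {n : ℕ} {k : Fin n → ℤ} {R : ℝ} (hR : 0 ≤ R) (hk : ∀ i, |(k i : ℝ)| ≤ R) :
    ‖intVec n k‖ ≤ Real.sqrt n * R := by
  rw [EuclideanSpace.norm_eq]
  refine Real.sqrt_le_iff.2 ⟨by positivity, ?_⟩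
  rw [mul_pow, Real.sq_sqrt (Nat.cast_nonneg n)]
  calc ∑ i, ‖intVec n k i‖ ^ 2 ≤ ∑ _i : Fin n, R ^ 2 :=
        Finset.sum_le_sum fun i _ => pow_le_pow_left₀ (norm_nonneg _) (hk i) 2
    _ = n * R ^ 2 := by simp

/-- A linear flow whose direction vector has no small divisors `|k · α| < ω` in the ball of radius
`n / δ` fills the torus to within `δ` after time `28 / ω`. -/
theorem fills_of_le_abs_inner {n : ℕ} (hn : n ≠ 0) {α : EuclideanSpace ℝ (Fin n)} {δ ω : ℝ}
    (hδ : 0 < δ) (hδ' : δ < 1) (hω : 0 < ω)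
    (h : ∀ k : Fin n → ℤ, k ≠ 0 → ‖intVec n k‖ ≤ n / δ → ω ≤ |inner ℝ (intVec n k) α|) :
    Fills α δ (28 / ω) := by
  intro θ p
  obtain ⟨u, rfl⟩ := QuotientAddGroup.mk_surjective θ
  obtain ⟨v, rfl⟩ := QuotientAddGroup.mk_surjective p
  have hn1 : (1 : ℝ) ≤ n := by exact_mod_cast Nat.one_le_iff_ne_zero.2 hn
  -- With `M = ⌈R⌉`, the box `|k i| ≤ M - 1 < R` lies in the ball of radius `√n R = n / δ`, while `n
  -- = δ² R² ≤ δ² M²`.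
  set R := Real.sqrt n / δ with hR
  have hR1 : 1 < R := by
    rw [hR, lt_div_iff₀ hδ]
    linarith [Real.one_le_sqrt.2 hn1]
  have hRM := Nat.le_ceil R
  have hMR := Nat.ceil_lt_add_one (zero_le_one.trans hR1.le)
  obtain ⟨t, ht, hlt⟩ := exists_sum_sub_round_sq_lt (M := ⌈R⌉₊)
    (by have : (1 : ℝ) < (⌈R⌉₊ : ℝ) := hR1.trans_le hRM
        exact_mod_cast this)
    -- The factor `2 / ω` raises the divisors to 2; the shift `14 / ω` carries the window `[-7, 7]`
    -- to times in `[0, 28 / ω]`.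
    (fun i => u i - v i + 14 / ω * α i) (fun i => 2 / ω * α i) (fun k hk hkM => by
      have hle := h k hk ((norm_intVec_le (zero_le_one.trans hR1.le)
        fun i => (hkM i).trans (by linarith)).trans_eq (by
          rw [hR, ← mul_div_assoc, Real.mul_self_sqrt (Nat.cast_nonneg n)]))
      have e : ∑ i, (k i : ℝ) * (2 / ω * α i) = 2 / ω * inner ℝ (intVec n k) α := by
        rw [inner_intVec, Finset.mul_sum]
        exact Finset.sum_congr rfl fun i _ => by ring
      rw [e, abs_mul, abs_of_pos (by positivity : 0 < 2 / ω), div_mul_eq_mul_div,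
        le_div_iff₀ hω]
      linarith) hδ (by
      calc (n : ℝ) = δ ^ 2 * R ^ 2 := by
            rw [hR, div_pow, Real.sq_sqrt (Nat.cast_nonneg n)]; field_simp
        _ ≤ _ := by gcongr)
  obtain ⟨ht1, ht2⟩ := abs_le.1 ht
  refine ⟨linearFlow α ((14 + 2 * t) / ω) u, ?_, (14 + 2 * t) / ω, ?_, ?_, rfl⟩
  · rw [Metric.mem_closedBall, dist_eq_norm, linearFlow, ← QuotientAddGroup.mk_add,
      ← QuotientAddGroup.mk_sub]
    refine norm_mk_le_of_sum_sub_round _ hδ.le (le_of_eq_of_le ?_ hlt.le)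
    refine Finset.sum_congr rfl fun i _ => ?_
    have e : (u + ((14 + 2 * t) / ω) • α - v) i = u i - v i + 14 / ω * α i + 2 / ω * α i * t := by
      simp
      ring
    rw [e]
  · exact div_nonneg (by linarith) hω.le
  · gcongr; linarith

theorem twentyEight_mul_rpow_lt_fillingConst {n : ℕ} (hn : 2 ≤ n) {τ : ℝ} (hτ : 1 < τ) :
    28 * (n : ℝ) ^ τ < fillingConst n τ := by
  have hn' : (2 : ℝ) ≤ n := by exact_mod_cast hn
  have hfac : (2 : ℝ) ≤ n ! := by
    have : 2 ! ≤ n ! := Nat.factorial_le hn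
    exact_mod_cast this
  have hbase : 4 * (n : ℝ) ≤ 1 + (n : ℝ) ^ 2 * (n ! : ℝ) := by nlinarith
  have h4 : (4 : ℝ) ≤ 4 ^ τ := by
    simpa using Real.rpow_le_rpow_of_exponent_le (by norm_num : (1 : ℝ) ≤ 4) hτ.le
  have hpos : 0 < (n : ℝ) ^ τ := by positivity
  calc 28 * (n : ℝ) ^ τ < 4 * (n : ℝ) ^ τ * (4 * 2) := by linarith
    _ ≤ 4 ^ τ * (n : ℝ) ^ τ * (4 * n) := by gcongr
    _ = (4 * (n : ℝ)) ^ (τ + 1) := by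
        rw [Real.rpow_add (by positivity), Real.rpow_one,
          Real.mul_rpow (by norm_num) (by positivity)]
    _ ≤ _ := Real.rpow_le_rpow (by positivity) hbase (by linarith)

end TorusFilling

theorem corollary1 (n : ℕ) (hn : 2 ≤ n) (τ γ : ℝ) (hτ : (n : ℝ) - 1 < τ)
    (hγ : γ ∈ Set.Ioo (0 : ℝ) 1)
    (hne : (TorusFilling.unitDiophantine n τ γ).Nonempty)
    (δ : ℝ) (hδ : δ ∈ Set.Ioo (0 : ℝ) (1 / 2))
    (α : EuclideanSpace ℝ (Fin n)) (hα : α ∈ TorusFilling.unitDiophantine n τ γ) :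
    ∃ T : ℝ, 0 ≤ T ∧ T < TorusFilling.fillingConst n τ / (γ * δ ^ τ) ∧
      TorusFilling.Fills α δ T := by
  have hδ0 := hδ.1
  have hγ0 := hγ.1
  have hn' : (2 : ℝ) ≤ n := by exact_mod_cast hn
  have hτ1 : 1 < τ := by linarith
  have hω : 0 < γ * ((n : ℝ) / δ) ^ (-τ) := by positivity
  refine ⟨28 / (γ * ((n : ℝ) / δ) ^ (-τ)), by positivity, ?_,
    TorusFilling.fills_of_le_abs_inner (by omega) hδ0 (by linarith [hδ.2]) hω fun k hk hkn => ?_⟩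
  · have e : 28 / (γ * ((n : ℝ) / δ) ^ (-τ)) = 28 * (n : ℝ) ^ τ / (γ * δ ^ τ) := by
      rw [Real.rpow_neg (by positivity), Real.div_rpow (by positivity) hδ0.le]
      field_simp
    rw [e]
    have := TorusFilling.twentyEight_mul_rpow_lt_fillingConst hn hτ1
    gcongr
  · refine le_trans ?_ (hα.2 k hk)
    have : 0 < ‖TorusFilling.intVec n k‖ := norm_pos_iff.2 (TorusFilling.intVec_eq_zero.not.2 hk)
    exact mul_le_mul_of_nonneg_left
      (Real.rpow_le_rpow_of_nonpos this hkn (by linarith)) hγ0.le
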